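/- Let $K$ be a field and let $n,d\ge 0$. Let $S=K[x_0,\dots,x_n]$, regarded as a divided power ring, and let $T=K[y_0,\dots,y_n]$ act on $S$ by contraction: $y^\alpha(x^{[\beta]})=x^{[\beta-\alpha]}$ if $\alpha\le\beta$ componentwise, and $y^\alpha(x^{[\beta]})=0$ otherwise. Likewise let $K[y_1,\dots,y_n]$ act on $K[x_1,\dots,x_n]$ by contraction. For a polynomial $h$ let $h^\perp$ denote the ideal of all operators $\varphi$ with $\varphi(h)=0$. A closed subscheme $\Gamma\subset\mathbb P^n=\operatorname{Proj}T$ is called apolar to a form $F\in S$ if its homogeneous ideal $I_\Gamma\subset T$ is contained in $F^\perp$. For $g\in K[x_1,\dots,x_n]$, the affine apolar scheme of $g$ is the subscheme $$Z_g=V(g^\perp)\subset\operatorname{Spec}K[y_1,\dots,y_n]=\{y_0\ne 0\}\subset\mathbb P^n .$$ If $g=g_0+g_1+\cdots+g_e$ is the decomposition of $g$ into homogeneous summands, $\deg g_k=k$, its degree-$d$ tail is $g_{\le d}=\sum_{k\le d}g_k$ (so $g_{\le d}=g$ if $d>e$). Proposition. Let $F\in K[x_0,\dots,x_n]$ be a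 nonzero homogeneous polynomial of degree $d$, and let $f=F(1,x_1,\dots,x_n)$, where the dehomogenization sends $x_0^{[a_0]}x_1^{[a_1]}\cdots x_n^{[a_n]}$ to $x_1^{[a_1]}\cdots x_n^{[a_n]}$. Let $\Gamma\subset\mathbb P^n$ be a scheme of minimal length among the local schemes supported at the point $[1:0:\cdots:0]$ that are apolar to $F$. Then there is a polynomial $g\in K[x_1,\dots,x_n]$ with $g_{\le d}=f$ such that $\Gamma=Z_g$ as subschemes of $\mathbb P^n$. -/

import Mathlib

open MvPolynomial AlgebraicGeometry CategoryTheory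

universe u

noncomputable section

namespace LocalApolar

/-! ### Contraction and annihilators

The divided power ring in the variables `σ` has the `K`-basis `x^[β]`, `β : σ →₀ ℕ`.  As a
`K`-vector space it is represented by `MvPolynomial σ K`, the basis element `x^[β]` being
`monomial β 1`.  The ring of operators is the polynomial ring `MvPolynomial σ K` in the dual
variables `y`. -/

section Contraction

variable {σ : Type*} {K : Type*} [Field K]

open Classical in
/-- The contraction action of operators on (divided power) polynomials: the `K`-bilinear map with
`y^α (x^[β]) = x^[β - α]` if `α ≤ β`, and `y^α (x^[β]) = 0` otherwise. -/
def contraction : MvPolynomial σ K →ₗ[K] MvPolynomial σ K →ₗ[K] MvPolynomial σ K :=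
  (basisMonomials σ K).constr K fun α =>
    (basisMonomials σ K).constr K fun β =>
      if α ≤ β then monomial (β - α) (1 : K) else 0

open Classical in
theorem contraction_monomial (α β : σ →₀ ℕ) :
    contraction (monomial α (1 : K)) (monomial β (1 : K)) =
      if α ≤ β then monomial (β - α) (1 : K) else 0 := by
  have h (γ : σ →₀ ℕ) : monomial γ (1 : K) = basisMonomials σ K γ := by simp
  rw [h α, h β, contraction, Module.Basis.constr_basis, Module.Basis.constr_basis]

theorem contraction_mul (φ ψ f : MvPolynomial σ K) :
    contraction (φ * ψ) f = contraction φ (contraction ψ f) := by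
  classical
  induction φ using MvPolynomial.induction_on' with
  | add p q hp hq => simp [add_mul, hp, hq]
  | monomial α a =>
    induction ψ using MvPolynomial.induction_on' with
    | add p q hp hq => simp [mul_add, hp, hq]
    | monomial β b =>
      induction f using MvPolynomial.induction_on' with
      | add p q hp hq => rw [map_add, map_add, map_add, hp, hq]
      | monomial γ c =>
        have e (δ : σ →₀ ℕ) (r : K) : monomial δ r = r • monomial δ (1 : K) := by
          simp [smul_monomial]
        rw [monomial_mul, e (α + β), e α, e β, e γ]
        simp only [map_smul, LinearMap.smul_apply, contraction_monomial]
        by_cases hβ : β ≤ γ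
        · by_cases hα : α ≤ γ - β
          · have : α + β ≤ γ := by
              have := add_le_add_left hα β
              rwa [tsub_add_cancel_of_le hβ] at this
            simp only [hβ, hα, this, if_true, contraction_monomial]
            rw [add_comm α β, ← tsub_tsub]
            simp only [smul_smul]
            congr 1
            ring
          · have : ¬ α + β ≤ γ := fun h => hα (le_tsub_of_add_le_right h)
            simp [hβ, hα, this, contraction_monomial]
        · have : ¬ α + β ≤ γ := fun h => hβ (le_trans (le_add_of_nonneg_left (zero_le)) h)
          simp [hβ, this]

/-- The annihilator `f^⊥` of `f`: the ideal of all operators `φ` with `φ(f) = 0`. -/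
def annihilator (f : MvPolynomial σ K) : Ideal (MvPolynomial σ K) where
  carrier := {φ | contraction φ f = 0}
  zero_mem' := by simp
  add_mem' := by
    intro a b ha hb
    simp only [Set.mem_ofPred_eq] at ha hb ⊢
    simp [ha, hb]
  smul_mem' := by
    intro c φ hφ
    simp only [Set.mem_ofPred_eq, smul_eq_mul] at hφ ⊢
    rw [contraction_mul, hφ, map_zero]

/-- The tail `g_{≤ d} = g_0 + ⋯ + g_d` of `g`, where `g_k` is the homogeneous summand of
degree `k`. -/
def tail (d : ℕ) (g : MvPolynomial σ K) : MvPolynomial σ K :=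
  ∑ k ∈ Finset.range (d + 1), homogeneousComponent k g

end Contraction

variable (K : Type u) [Field K] (n : ℕ)

/-- The dehomogenization `F(1, x_1, …, x_n)` of `F(x_0, …, x_n)`. -/
def dehomogenize : MvPolynomial (Fin (n + 1)) K →ₐ[K] MvPolynomial (Fin n) K :=
  aeval (Fin.cons 1 X)

/-! ### Projective space -/

/-- The grading by degree of `T = K[y_0, …, y_n]`. -/
abbrev grading : ℕ → Submodule K (MvPolynomial (Fin (n + 1)) K) :=
  homogeneousSubmodule (Fin (n + 1)) K

instance : GradedAlgebra (grading K n) := gradedAlgebra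

/-- Projective space `ℙⁿ = Proj K[y_0, …, y_n]`. -/
abbrev projSpace : Scheme.{u} := Proj (grading K n)

/-- The structure morphism `ℙⁿ ⟶ Spec K`. -/
def toSpecField : projSpace K n ⟶ Spec (CommRingCat.of K) :=
  Proj.toSpecZero (grading K n) ≫
    Spec.map (CommRingCat.ofHom (algebraMap K (grading K n 0)))

theorem X_mem_grading (j : Fin (n + 1)) :
    (X j : MvPolynomial (Fin (n + 1)) K) ∈ grading K n 1 :=
  isHomogeneous_X K j

/-- The homogeneous ideal `(y_1, …, y_n)`. -/
def pointIdeal : HomogeneousIdeal (grading K n) where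
  toSubmodule := Ideal.span (Set.range fun j : Fin n => X j.succ)
  is_homogeneous' := by
    refine Ideal.homogeneous_span _ _ ?_
    rintro _ ⟨j, rfl⟩
    exact ⟨1, X_mem_grading K n j.succ⟩

/-- The substitution `y_0 ↦ y_0`, `y_j ↦ 0` for `j ≥ 1`, whose kernel is `(y_1, …, y_n)`. -/
def pointSubst : MvPolynomial (Fin (n + 1)) K →ₐ[K] MvPolynomial (Fin (n + 1)) K :=
  aeval (Fin.cons (X 0) fun _ => 0)

theorem pointIdeal_eq_ker : (pointIdeal K n).toIdeal = RingHom.ker (pointSubst K n) := by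
  change Ideal.span (Set.range fun j : Fin n => X j.succ) = _
  apply le_antisymm
  · rw [Ideal.span_le]
    rintro _ ⟨j, rfl⟩
    simp [pointSubst]
  · have h (p : MvPolynomial (Fin (n + 1)) K) : p - pointSubst K n p ∈
        Ideal.span (Set.range fun j : Fin n => (X j.succ : MvPolynomial (Fin (n + 1)) K)) := by
      induction p using MvPolynomial.induction_on with
      | C a => simp [pointSubst]
      | add p q hp hq =>
        rw [map_add, add_sub_add_comm]
        exact add_mem hp hq
      | mul_X p j hp =>
        rw [map_mul]
        have hj : (X j : MvPolynomial (Fin (n + 1)) K) - pointSubst K n (X j) ∈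
            Ideal.span (Set.range fun j : Fin n =>
              (X j.succ : MvPolynomial (Fin (n + 1)) K)) := by
          induction j using Fin.cases with
          | zero => simp [pointSubst]
          | succ j =>
            simp only [pointSubst, aeval_X, Fin.cons_succ, sub_zero]
            exact Ideal.subset_span ⟨j, rfl⟩
        have : p * X j - pointSubst K n p * pointSubst K n (X j) =
            (X j) * (p - pointSubst K n p) + pointSubst K n p * (X j - pointSubst K n (X j)) := by
          ring
        rw [this]
        exact add_mem (Ideal.mul_mem_left _ _ hp) (Ideal.mul_mem_left _ _ hj)
    intro p hp
    have := h p
    rwa [RingHom.mem_ker.mp hp, sub_zero] at this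

/-- The point `[1 : 0 : ⋯ : 0]` of `ℙⁿ`, that is, the homogeneous prime `(y_1, …, y_n)`. -/
def point : projSpace K n where
  asHomogeneousIdeal := pointIdeal K n
  isPrime := by
    rw [pointIdeal_eq_ker]
    exact RingHom.ker_isPrime _
  not_irrelevant_le := by
    intro h
    have h0 : (X 0 : MvPolynomial (Fin (n + 1)) K) ∈
        HomogeneousIdeal.irrelevant (grading K n) := by
      rw [HomogeneousIdeal.mem_irrelevant_iff, GradedRing.proj_apply,
        DirectSum.decompose_of_mem_ne _ (X_mem_grading K n 0) one_ne_zero]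
    have h1 : (X 0 : MvPolynomial (Fin (n + 1)) K) ∈ (pointIdeal K n).toIdeal := h h0
    rw [pointIdeal_eq_ker, RingHom.mem_ker] at h1
    simp [pointSubst] at h1

/-! ### The affine chart `U' = Spec K[y_1, …, y_n]`, complement of `y_0 = 0` -/

/-- The ring homomorphism from the degree zero part of `K[y_0, …, y_n][1 / y_0]` to
`K[y_1, …, y_n]` given by `y_0 ↦ 1`. -/
def chartRingHom :
    HomogeneousLocalization.Away (grading K n) (X 0) →+* MvPolynomial (Fin n) K :=
  (IsLocalization.Away.lift (S := Localization.Away (X 0 : MvPolynomial (Fin (n + 1)) K)) (X 0)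
    (g := (dehomogenize K n : MvPolynomial (Fin (n + 1)) K →+* MvPolynomial (Fin n) K))
    (by simp [dehomogenize])).comp
  (algebraMap (HomogeneousLocalization.Away (grading K n) (X 0)) (Localization.Away (X 0)))

/-- The inclusion `Spec K[y_1, …, y_n] ⟶ ℙⁿ` of the complement of `y_0 = 0`. -/
def chart : Spec (CommRingCat.of (MvPolynomial (Fin n) K)) ⟶ projSpace K n :=
  Spec.map (CommRingCat.ofHom (chartRingHom K n)) ≫
    Proj.awayι (grading K n) (X 0) (X_mem_grading K n 0) one_pos

variable {K n}

/-- The affine apolar scheme `Z_g = V(g^⊥) = Spec K[y_1, …, y_n] / g^⊥` of a polynomial `g`. -/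
abbrev affineApolarScheme (g : MvPolynomial (Fin n) K) : Scheme.{u} :=
  Spec (CommRingCat.of (MvPolynomial (Fin n) K ⧸ annihilator g))

/-- The inclusion `Z_g ⊆ U' ⊆ ℙⁿ`. -/
def affineApolarSchemeι (g : MvPolynomial (Fin n) K) : affineApolarScheme g ⟶ projSpace K n :=
  Spec.map (CommRingCat.ofHom (Ideal.Quotient.mk (annihilator g))) ≫ chart K n

/-! ### Closed subschemes of projective space

A closed subscheme is given by a closed immersion `i : Γ ⟶ ℙⁿ`. -/

/-- For a form `Ψ` of degree `k`, the regular function `Ψ / y_j^k` on the open set `y_j ≠ 0`. -/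
def formQuotient (j : Fin (n + 1)) (k : ℕ) (Ψ : MvPolynomial (Fin (n + 1)) K)
    (hΨ : Ψ ∈ grading K n k) :
    Γ(projSpace K n, Proj.basicOpen (grading K n) (X j)) :=
  Proj.awayToSection (grading K n) (X j)
    (HomogeneousLocalization.Away.mk (grading K n) (X_mem_grading K n j) k Ψ (by simpa using hΨ))

/-- The homogeneous ideal `I_Γ` of `Γ ⊆ ℙⁿ`: it is generated by the forms `Ψ` that vanish on `Γ`,
that is, for which the restriction to `Γ` of the function `Ψ / y_j^k`, `k = deg Ψ`, vanishes for
every `j`. -/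
def idealOf {Γ : Scheme.{u}} (i : Γ ⟶ projSpace K n) : Ideal (MvPolynomial (Fin (n + 1)) K) :=
  Ideal.span {Ψ | ∃ (k : ℕ) (hΨ : Ψ ∈ grading K n k), ∀ j : Fin (n + 1),
    i.app (Proj.basicOpen (grading K n) (X j)) (formQuotient j k Ψ hΨ) = 0}

/-- `Γ ⊆ ℙⁿ` is apolar to the form `F` if `I_Γ ⊆ F^⊥`. -/
def IsApolar {Γ : Scheme.{u}} (i : Γ ⟶ projSpace K n) (F : MvPolynomial (Fin (n + 1)) K) : Prop :=
  idealOf i ≤ annihilator F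

/-- `Γ` is a local scheme supported at `[1 : 0 : ⋯ : 0]`. -/
def IsLocalAtPoint {Γ : Scheme.{u}} (i : Γ ⟶ projSpace K n) : Prop :=
  Set.range i = {point K n}

/-- The ring homomorphism `K → Γ(Γ, 𝒪)` of a scheme over `ℙⁿ`. -/
def scalars {Γ : Scheme.{u}} (i : Γ ⟶ projSpace K n) : K →+* Γ(Γ, ⊤) :=
  (i ≫ toSpecField K n).appTop.hom.comp (Scheme.ΓSpecIso (CommRingCat.of K)).inv.hom

/-- The length `dim_K Γ(Γ, 𝒪)` of a finite subscheme `Γ ⊆ ℙⁿ`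
(with value `⊤` if this dimension is infinite). -/
def length {Γ : Scheme.{u}} (i : Γ ⟶ projSpace K n) : ℕ∞ :=
  letI : Module K Γ(Γ, ⊤) := Module.compHom _ (scalars i)
  Module.length K Γ(Γ, ⊤)

end LocalApolar

end

/-! Since `Γ` is supported at the origin of the chart `y_0 ≠ 0`, it is `V(I)` for an ideal `I` of
`K[y_1, …, y_n]` containing a power of each variable. Pair operators with polynomials by taking the
constant term of `φ(f)`. Apolarity to `F` says that `f` pairs to zero with every element of `I` of
degree at most `d`. The pairing with `f` therefore descends to the image of the operators of degree
`≤ d` in `K[y]/I`, and extends to a functional on all of `K[y]/I`. As `I` contains almost all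
monomials, this functional is the pairing with a polynomial `g`; then `g_{≤ d} = f` and `I ⊆ g^⊥`
(`exists_tail_eq_of_le`).

Conversely, any `g` with tail `f` gives a scheme apolar to `F`
(`mem_annihilator_of_dehomogenize_mem`). So `Z_g ⊆ Γ` is a competitor, nonempty because `f ≠ 0`, and
minimality of the finite length of `Γ` forces `I = g^⊥` (`eq_of_le_of_length_le`). -/

namespace LocalApolar

/-! ### The constant-term pairing and extension of functionals. -/

section Pairing

variable {σ K : Type*} [Field K]

theorem contraction_eq_sum (φ f : MvPolynomial σ K) :
    contraction φ f = ∑ α ∈ φ.support, coeff α φ • contraction (monomial α 1) f := by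
  conv_lhs => rw [φ.as_sum]
  rw [map_sum, LinearMap.sum_apply]
  refine Finset.sum_congr rfl fun α _ => ?_
  rw [← LinearMap.smul_apply, ← map_smul, smul_monomial, smul_eq_mul, mul_one]

theorem coeff_zero_contraction_monomial (α : σ →₀ ℕ) (f : MvPolynomial σ K) :
    coeff 0 (contraction (monomial α 1) f) = coeff α f := by
  classical
  induction f using MvPolynomial.induction_on' with
  | add p q hp hq => simp [hp, hq]
  | monomial β b =>
    have e : monomial β b = b • monomial β (1 : K) := by simp [smul_monomial]
    rw [e, map_smul, contraction_monomial]
    split_ifs with h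
    · simp only [coeff_smul, coeff_monomial, tsub_eq_zero_iff_le]
      congr 1
      exact if_congr ⟨fun h' => le_antisymm h' h, fun h' => h'.le⟩ rfl rfl
    · have : β ≠ α := fun h' => h h'.ge
      simp [coeff_monomial, this]

/-- The constant term of `φ(f)` is the coefficientwise pairing of `φ` and `f`. -/
theorem coeff_zero_contraction (φ f : MvPolynomial σ K) :
    coeff 0 (contraction φ f) = ∑ α ∈ φ.support, coeff α φ * coeff α f := by
  rw [contraction_eq_sum, coeff_sum]
  simp [coeff_zero_contraction_monomial]

theorem mem_annihilator {φ f : MvPolynomial σ K} : φ ∈ annihilator f ↔ contraction φ f = 0 :=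
  Iff.rfl

/-- The coefficient of `φ(f)` at `γ` is the constant term of `(y^γ φ)(f)`, so an ideal lies in `f^⊥`
as soon as all its elements pair to zero with `f`. -/
theorem mem_annihilator_iff {φ f : MvPolynomial σ K} :
    φ ∈ annihilator f ↔ ∀ γ, coeff 0 (contraction (monomial γ 1 * φ) f) = 0 := by
  simp only [mem_annihilator, contraction_mul, coeff_zero_contraction_monomial]
  exact MvPolynomial.ext_iff

theorem annihilator_ne_top {f : MvPolynomial σ K} (hf : f ≠ 0) : annihilator f ≠ ⊤ := by
  intro h
  have h1 : (1 : MvPolynomial σ K) ∈ annihilator f := h ▸ Submodule.mem_top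
  refine hf (MvPolynomial.ext _ _ fun α => ?_)
  simpa [coeff_zero_contraction_monomial] using mem_annihilator_iff.mp h1 α

theorem coeff_tail (d : ℕ) (g : MvPolynomial σ K) (α : σ →₀ ℕ) :
    coeff α (tail d g) = if α.degree ≤ d then coeff α g else 0 := by
  classical
  simp only [tail, coeff_sum, coeff_homogeneousComponent]
  rw [Finset.sum_ite_eq]
  simp

theorem coeff_zero_contraction_tail {d : ℕ} {φ : MvPolynomial σ K} (hφ : φ.totalDegree ≤ d)
    (g : MvPolynomial σ K) :
    coeff 0 (contraction φ (tail d g)) = coeff 0 (contraction φ g) := by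
  rw [coeff_zero_contraction, coeff_zero_contraction]
  refine Finset.sum_congr rfl fun α hα => ?_
  rw [coeff_tail, if_pos]
  exact (le_totalDegree hα).trans hφ

/-- A functional vanishing on the elements of degree at most `d` of an ideal containing almost all
monomials is given on elements of degree at most `d` by some `g` whose annihilator contains the
ideal. -/
theorem exists_tail_eq_of_le {d : ℕ} {I : Ideal (MvPolynomial σ K)}
    (hI : {α | monomial α (1 : K) ∉ I}.Finite) {f : MvPolynomial σ K} (hf : f.totalDegree ≤ d)
    (h : ∀ ψ ∈ I, ψ.totalDegree ≤ d → coeff 0 (contraction ψ f) = 0) :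
    ∃ g, tail d g = f ∧ I ≤ annihilator g := by
  classical
  let W := restrictTotalDegree σ K d
  let q : W →ₗ[K] (MvPolynomial σ K ⧸ I) := (Ideal.Quotient.mkₐ K I).toLinearMap ∘ₗ W.subtype
  let l : W →ₗ[K] K := (lcoeff K 0 ∘ₗ contraction.flip f) ∘ₗ W.subtype
  -- Over a field, a functional on `W` extends along `q` exactly when it vanishes on `ker q`, here
  -- the elements of `I` of degree `≤ d`.
  have hl : l ∈ LinearMap.range q.dualMap := by
    rw [LinearMap.range_dualMap_eq_dualAnnihilator_ker, Submodule.mem_dualAnnihilator]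
    intro w hw
    refine h w.1 ?_ ((mem_restrictTotalDegree _ _ _).mp w.2)
    exact Ideal.Quotient.eq_zero_iff_mem.mp hw
  obtain ⟨m, hm⟩ := hl
  let μ : MvPolynomial σ K →ₗ[K] K := m ∘ₗ (Ideal.Quotient.mkₐ K I).toLinearMap
  have hμI : ∀ ψ ∈ I, μ ψ = 0 := fun ψ hψ => by
    have : Ideal.Quotient.mkₐ K I ψ = 0 := Ideal.Quotient.eq_zero_iff_mem.mpr hψ
    simp [μ, -Ideal.Quotient.mkₐ_eq_mk, this]
  have hμW : ∀ ψ : MvPolynomial σ K, ψ.totalDegree ≤ d → μ ψ = coeff 0 (contraction ψ f) :=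
    fun ψ hψ => LinearMap.congr_fun hm ⟨ψ, (mem_restrictTotalDegree _ _ _).mpr hψ⟩
  -- The omitted monomials lie in `I`, where `μ` vanishes, so this finite sum records every value of
  -- `μ` on monomials.
  let g : MvPolynomial σ K := ∑ α ∈ hI.toFinset, monomial α (μ (monomial α 1))
  have hg (α) : coeff α g = μ (monomial α 1) := by
    simp only [g, coeff_sum, coeff_monomial, Finset.sum_ite_eq']
    split_ifs with h'
    · rfl
    · exact (hμI _ (by simpa using h')).symm
  have hμg (ψ) : coeff 0 (contraction ψ g) = μ ψ := by
    rw [coeff_zero_contraction]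
    conv_rhs => rw [ψ.as_sum]
    rw [map_sum]
    refine Finset.sum_congr rfl fun α _ => ?_
    rw [hg, ← smul_eq_mul, ← map_smul, smul_monomial, smul_eq_mul, mul_one]
  refine ⟨g, ?_, fun ψ hψ => mem_annihilator_iff.mpr fun γ => ?_⟩
  · ext α
    rw [coeff_tail]
    split_ifs with hα
    · rw [hg, hμW, coeff_zero_contraction_monomial]
      rwa [totalDegree_monomial _ one_ne_zero]
    · refine (coeff_eq_zero_of_totalDegree_lt ?_).symm
      exact hf.trans_lt (not_le.mp hα)
  · rw [hμg]
    exact hμI _ (I.mul_mem_left _ hψ)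

/-- If `X j ^ N j ∈ I` for all `j`, exponents outside `I` stay in the box bounded by `N`. -/
theorem finite_monomial_notMem [Finite σ] {I : Ideal (MvPolynomial σ K)}
    (h : ∀ j, X j ∈ I.radical) : {α | monomial α (1 : K) ∉ I}.Finite := by
  choose N hN using h
  have : {α : σ →₀ ℕ | ∀ j, α j ≤ N j}.Finite := by
    have := Fintype.ofFinite σ
    classical
    exact (Set.finite_Iic (Finsupp.equivFunOnFinite.symm N)).subset fun α hα j => hα j
  refine this.subset fun α hα j => ?_
  by_contra! hj
  refine hα ?_
  have : monomial α (1 : K) = monomial (α - Finsupp.single j (N j)) 1 * X j ^ N j := by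
    rw [X_pow_eq_monomial, monomial_mul, one_mul, tsub_add_cancel_of_le]
    simpa using hj.le
  rw [this]
  exact I.mul_mem_left _ (hN j)

theorem finite_quotient_of_X_mem_radical [Finite σ] {I : Ideal (MvPolynomial σ K)}
    (h : ∀ j, X j ∈ I.radical) : Module.Finite K (MvPolynomial σ K ⧸ I) := by
  refine ⟨⟨((finite_monomial_notMem h).image
    fun α => Ideal.Quotient.mkₐ K I (monomial α 1)).toFinset, ?_⟩⟩
  rw [Set.Finite.coe_toFinset, eq_top_iff]
  rintro x -
  obtain ⟨p, rfl⟩ := Ideal.Quotient.mkₐ_surjective K I x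
  rw [p.as_sum, map_sum]
  refine Submodule.sum_mem _ fun α _ => ?_
  rw [← mul_one (coeff α p), ← smul_eq_mul, ← smul_monomial, map_smul]
  refine Submodule.smul_mem _ _ ?_
  by_cases hα : monomial α (1 : K) ∈ I
  · have : Ideal.Quotient.mkₐ K I (monomial α 1) = 0 := Ideal.Quotient.eq_zero_iff_mem.mpr hα
    rw [this]
    exact zero_mem _
  · exact Submodule.subset_span ⟨α, hα, rfl⟩

end Pairing

/-! ### Forms and their dehomogenizations. -/

section Dehomogenize

variable {K : Type*} [Field K] {n : ℕ}

theorem degree_eq_of_coeff_ne_zero {σ : Type*} {d : ℕ} {F : MvPolynomial σ K}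
    (hF : F.IsHomogeneous d) {α : σ →₀ ℕ} (hα : coeff α F ≠ 0) : α.degree = d := by
  rw [Finsupp.degree_eq_weight_one]
  exact hF hα

theorem dehomogenize_monomial (α : Fin (n + 1) →₀ ℕ) (a : K) :
    dehomogenize K n (monomial α a) = monomial α.tail a := by
  rw [dehomogenize, aeval_monomial, monomial_eq, algebraMap_eq, Finsupp.prod_fintype _ _ (by simp),
    Finsupp.prod_fintype _ _ (by simp), Fin.prod_univ_succ]
  simp [Finsupp.tail_apply]

theorem dehomogenize_eq_sum (Ψ : MvPolynomial (Fin (n + 1)) K) :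
    dehomogenize K n Ψ = ∑ α ∈ Ψ.support, monomial α.tail (coeff α Ψ) := by
  conv_lhs => rw [Ψ.as_sum]
  simp only [map_sum, dehomogenize_monomial]

theorem degree_eq_zero_add_degree_tail (α : Fin (n + 1) →₀ ℕ) :
    α.degree = α 0 + α.tail.degree := by
  simp [Finsupp.degree_eq_sum, Fin.sum_univ_succ, Finsupp.tail_apply]

theorem totalDegree_dehomogenize_le {d : ℕ} {Ψ : MvPolynomial (Fin (n + 1)) K}
    (hΨ : Ψ.IsHomogeneous d) : (dehomogenize K n Ψ).totalDegree ≤ d := by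
  rw [dehomogenize_eq_sum]
  refine totalDegree_finsetSum_le fun α hα => (totalDegree_monomial_le _ _).trans ?_
  have h := degree_eq_zero_add_degree_tail α
  rw [degree_eq_of_coeff_ne_zero hΨ (mem_support_iff.mp hα)] at h
  change α.tail.degree ≤ d
  omega

/-- With the total degree fixed, the tail of an exponent determines its zeroth entry, so no two
monomials of `F` merge. -/
theorem coeff_tail_dehomogenize {d : ℕ} {F : MvPolynomial (Fin (n + 1)) K}
    (hF : F.IsHomogeneous d) {α : Fin (n + 1) →₀ ℕ} (hα : α.degree = d) :
    coeff α.tail (dehomogenize K n F) = coeff α F := by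
  classical
  rw [dehomogenize_eq_sum, coeff_sum, Finset.sum_eq_single α]
  · simp
  · intro β hβ hne
    rw [coeff_monomial, if_neg]
    intro h
    have h1 := degree_eq_zero_add_degree_tail α
    have h2 := degree_eq_zero_add_degree_tail β
    have h3 : β.degree = d := degree_eq_of_coeff_ne_zero hF (mem_support_iff.mp hβ)
    rw [h] at h2
    refine hne ?_
    rw [← Finsupp.cons_tail α, ← Finsupp.cons_tail β, h, show β 0 = α 0 by omega]
  · intro h
    simpa using notMem_support_iff.mp h

theorem dehomogenize_eq_zero {d : ℕ} {F : MvPolynomial (Fin (n + 1)) K}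
    (hF : F.IsHomogeneous d) (h : dehomogenize K n F = 0) : F = 0 := by
  ext α
  by_cases hα : α.degree = d
  · rw [← coeff_tail_dehomogenize hF hα, h, coeff_zero, coeff_zero]
  · by_contra h'
    exact hα (degree_eq_of_coeff_ne_zero hF h')

theorem coeff_zero_contraction_dehomogenize {d : ℕ} {Ψ F : MvPolynomial (Fin (n + 1)) K}
    (hΨ : Ψ.IsHomogeneous d) (hF : F.IsHomogeneous d) :
    coeff 0 (contraction (dehomogenize K n Ψ) (dehomogenize K n F)) =
      coeff 0 (contraction Ψ F) := by
  rw [coeff_zero_contraction Ψ, dehomogenize_eq_sum Ψ, map_sum, LinearMap.sum_apply, coeff_sum]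
  refine Finset.sum_congr rfl fun α hα => ?_
  rw [← mul_one (coeff α Ψ), ← smul_eq_mul, ← smul_monomial, map_smul, LinearMap.smul_apply,
    coeff_smul, coeff_zero_contraction_monomial, coeff_tail_dehomogenize hF]
  · simp
  · exact degree_eq_of_coeff_ne_zero hΨ (mem_support_iff.mp hα)

theorem coeff_zero_contraction_of_ne {d e : ℕ} (h : e ≠ d) {Ψ F : MvPolynomial (Fin (n + 1)) K}
    (hΨ : Ψ.IsHomogeneous e) (hF : F.IsHomogeneous d) : coeff 0 (contraction Ψ F) = 0 := by
  rw [coeff_zero_contraction]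
  refine Finset.sum_eq_zero fun α hα => ?_
  by_contra h'
  refine h ?_
  rw [← degree_eq_of_coeff_ne_zero hΨ (left_ne_zero_of_mul h'),
    ← degree_eq_of_coeff_ne_zero hF (right_ne_zero_of_mul h')]

theorem exists_isHomogeneous_dehomogenize_eq {d : ℕ} {ψ : MvPolynomial (Fin n) K}
    (hψ : ψ.totalDegree ≤ d) :
    ∃ Ψ : MvPolynomial (Fin (n + 1)) K, Ψ.IsHomogeneous d ∧ dehomogenize K n Ψ = ψ := by
  refine ⟨∑ α ∈ ψ.support, monomial (Finsupp.cons (d - α.degree) α) (coeff α ψ), ?_, ?_⟩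
  · refine IsHomogeneous.sum _ _ _ fun α hα => isHomogeneous_monomial _ ?_
    have h : α.degree ≤ d := (le_totalDegree hα).trans hψ
    rw [degree_eq_zero_add_degree_tail, Finsupp.tail_cons, Finsupp.cons_zero]
    omega
  · simp only [map_sum, dehomogenize_monomial, Finsupp.tail_cons]
    exact ψ.as_sum.symm

/-- If forms whose dehomogenization lies in `I` annihilate `F`, then the elements of `I` of degree
at most `deg F` pair to zero with the dehomogenization of `F`. -/
theorem coeff_zero_contraction_eq_zero_of_mem {d : ℕ} {F : MvPolynomial (Fin (n + 1)) K}
    (hF : F.IsHomogeneous d) {I : Ideal (MvPolynomial (Fin n) K)}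
    (h : ∀ Ψ : MvPolynomial (Fin (n + 1)) K, Ψ.IsHomogeneous d → dehomogenize K n Ψ ∈ I →
      Ψ ∈ annihilator F) {ψ : MvPolynomial (Fin n) K} (hψ : ψ ∈ I) (hd : ψ.totalDegree ≤ d) :
    coeff 0 (contraction ψ (dehomogenize K n F)) = 0 := by
  obtain ⟨Ψ, hΨ, rfl⟩ := exists_isHomogeneous_dehomogenize_eq hd
  rw [coeff_zero_contraction_dehomogenize hΨ hF, mem_annihilator.mp (h Ψ hΨ hψ), coeff_zero]

/-- Only multiples `y^γ Ψ` of degree exactly `d` can pair nontrivially with `F`. Their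
dehomogenizations have degree `≤ d`, so they cannot tell `g` from its tail, and they lie in the
ideal `g^⊥`. -/
theorem mem_annihilator_of_dehomogenize_mem {d k : ℕ} {F Ψ : MvPolynomial (Fin (n + 1)) K}
    (hF : F.IsHomogeneous d) (hΨ : Ψ.IsHomogeneous k) {g : MvPolynomial (Fin n) K}
    (hg : tail d g = dehomogenize K n F) (h : dehomogenize K n Ψ ∈ annihilator g) :
    Ψ ∈ annihilator F := by
  refine mem_annihilator_iff.mpr fun γ => ?_
  have hγ := (isHomogeneous_monomial (1 : K) (rfl : γ.degree = γ.degree)).mul hΨ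
  by_cases hk : γ.degree + k = d
  · rw [hk] at hγ
    rw [← coeff_zero_contraction_dehomogenize hγ hF, ← hg,
      coeff_zero_contraction_tail (totalDegree_dehomogenize_le hγ), map_mul, contraction_mul,
      mem_annihilator.mp h, map_zero, coeff_zero]
  · exact coeff_zero_contraction_of_ne hk hγ hF

end Dehomogenize

/-! ### The chart `y_0 ≠ 0` and subschemes supported at its origin. -/

section Chart

variable {K : Type u} [Field K] {n : ℕ}

theorem chartRingHom_mk (k : ℕ) (Ψ : MvPolynomial (Fin (n + 1)) K)
    (hΨ : Ψ ∈ grading K n (k • 1)) :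
    chartRingHom K n (HomogeneousLocalization.Away.mk (grading K n) (X_mem_grading K n 0) k Ψ hΨ) =
      dehomogenize K n Ψ := by
  rw [chartRingHom, RingHom.comp_apply, HomogeneousLocalization.algebraMap_apply,
    HomogeneousLocalization.Away.val_mk, Localization.mk_eq_mk', IsLocalization.Away.lift,
    IsLocalization.lift_mk'_spec]
  simp [dehomogenize]

theorem chartRingHom_bijective : Function.Bijective (chartRingHom K n) := by
  constructor
  · rw [injective_iff_map_eq_zero]
    intro a ha
    obtain ⟨k, Ψ, hΨ, rfl⟩ :=
      HomogeneousLocalization.Away.mk_surjective (grading K n) (X_mem_grading K n 0) a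
    rw [chartRingHom_mk] at ha
    obtain rfl := dehomogenize_eq_zero hΨ ha
    refine HomogeneousLocalization.val_injective _ ?_
    rw [HomogeneousLocalization.Away.val_mk, Localization.mk_zero, HomogeneousLocalization.val_zero]
  · intro ψ
    obtain ⟨Ψ, hΨ, rfl⟩ := exists_isHomogeneous_dehomogenize_eq (le_refl ψ.totalDegree)
    exact ⟨_, chartRingHom_mk _ Ψ (by simpa using hΨ)⟩

instance : IsIso (CommRingCat.ofHom (chartRingHom K n)) :=
  (ConcreteCategory.isIso_iff_bijective _).mpr chartRingHom_bijective

instance : IsOpenImmersion (chart K n) := by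
  unfold chart
  infer_instance

theorem opensRange_chart : (chart K n).opensRange = Proj.basicOpen (grading K n) (X 0) := by
  unfold chart
  rw [Scheme.Hom.opensRange_comp_of_isIso, Proj.opensRange_awayι]

theorem point_mem_basicOpen_X_zero : point K n ∈ Proj.basicOpen (grading K n) (X 0) := by
  rw [Proj.mem_basicOpen]
  intro h
  have h1 : (X 0 : MvPolynomial (Fin (n + 1)) K) ∈ (pointIdeal K n).toIdeal := h
  rw [pointIdeal_eq_ker, RingHom.mem_ker] at h1
  simp [pointSubst] at h1

theorem point_notMem_basicOpen_X_succ (j : Fin n) :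
    point K n ∉ Proj.basicOpen (grading K n) (X j.succ) := by
  rw [Proj.mem_basicOpen, not_not]
  exact Ideal.subset_span ⟨j, rfl⟩

theorem chart_preimage_basicOpen_X_succ (j : Fin n) :
    chart K n ⁻¹ᵁ Proj.basicOpen (grading K n) (X j.succ) =
      PrimeSpectrum.basicOpen (X j : MvPolynomial (Fin n) K) := by
  rw [chart, Scheme.Hom.comp_preimage, Proj.awayι_preimage_basicOpen _ _ _ (X_mem_grading K n _)
    one_pos]
  refine (PrimeSpectrum.comap_basicOpen _ _).trans ?_
  congr 1
  refine (chartRingHom_mk _ _ _).trans ?_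
  simp [dehomogenize]

/-- The closed subscheme of the chart defined by an ideal. -/
noncomputable def chartSubscheme (I : Ideal (MvPolynomial (Fin n) K)) :
    Spec (CommRingCat.of (MvPolynomial (Fin n) K ⧸ I)) ⟶ projSpace K n :=
  Spec.map (CommRingCat.ofHom (Ideal.Quotient.mk I)) ≫ chart K n

/-- Closed in the chart need not mean closed in `ℙⁿ`, so in general this is only a preimmersion. -/
instance (I : Ideal (MvPolynomial (Fin n) K)) : IsPreimmersion (chartSubscheme I) := by
  have : IsClosedImmersion (Spec.map (CommRingCat.ofHom (Ideal.Quotient.mk I))) :=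
    .spec_of_surjective _ Ideal.Quotient.mk_surjective
  unfold chartSubscheme
  infer_instance

theorem chartSubscheme_comp {I J : Ideal (MvPolynomial (Fin n) K)} (h : I ≤ J) :
    Spec.map (CommRingCat.ofHom (Ideal.Quotient.factor h)) ≫ chartSubscheme I =
      chartSubscheme J := by
  rw [chartSubscheme, ← Category.assoc, ← Spec.map_comp]
  rfl

/-- A closed subscheme of projective space supported at `[1 : 0 : ⋯ : 0]` is a closed subscheme of
the chart. -/
theorem exists_iso_chartSubscheme {Γ : Scheme.{u}} (i : Γ ⟶ projSpace K n) [IsClosedImmersion i]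
    (hloc : IsLocalAtPoint i) :
    ∃ (I : Ideal (MvPolynomial (Fin n) K))
      (e : Γ ≅ Spec (CommRingCat.of (MvPolynomial (Fin n) K ⧸ I))),
      e.hom ≫ chartSubscheme I = i := by
  have hr : Set.range i ⊆ Set.range (chart K n) := by
    rw [hloc, Set.singleton_subset_iff]
    have : point K n ∈ (chart K n).opensRange :=
      opensRange_chart (K := K) (n := n) ▸ point_mem_basicOpen_X_zero
    exact this
  let l := IsOpenImmersion.lift (chart K n) i hr
  have hl : l ≫ chart K n = i := IsOpenImmersion.lift_fac _ _ _
  have : IsClosedImmersion (l ≫ chart K n) := hl ▸ inferInstance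
  have : IsClosedImmersion l := .of_comp l (chart K n)
  obtain ⟨I, e, he⟩ := IsClosedImmersion.Spec_iff.mp this
  refine ⟨I, e, ?_⟩
  rw [chartSubscheme, ← Category.assoc, ← he, hl]

/-- Each prime over `I` is a point of the subscheme, hence maps to `[1 : 0 : ⋯ : 0]`, and so
contains every `y_j`. -/
theorem X_mem_radical_of_isLocalAtPoint {I : Ideal (MvPolynomial (Fin n) K)}
    (hloc : IsLocalAtPoint (chartSubscheme I)) (j : Fin n) : X j ∈ I.radical := by
  rw [Ideal.radical_eq_sInf, Submodule.mem_sInf]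
  rintro p ⟨hIp, hp⟩
  have hx : (⟨p, hp⟩ : PrimeSpectrum _) ∈
      Set.range (PrimeSpectrum.comap (Ideal.Quotient.mk I)) := by
    rw [range_comap_of_surjective _ _ Ideal.Quotient.mk_surjective]
    rw [Ideal.mk_ker]
    exact hIp
  obtain ⟨x, hx⟩ := hx
  have h1 : chartSubscheme I x = point K n := by
    have : chartSubscheme I x ∈ Set.range (chartSubscheme I) := ⟨x, rfl⟩
    rwa [hloc] at this
  have h2 : chart K n ⟨p, hp⟩ = point K n := by
    rw [← h1, ← hx]
    rfl
  by_contra hj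
  have h3 : (⟨p, hp⟩ : PrimeSpectrum _) ∈
    chart K n ⁻¹ᵁ Proj.basicOpen (grading K n) (X j.succ) := by
    rw [chart_preimage_basicOpen_X_succ]
    exact hj
  have h4 : chart K n ⟨p, hp⟩ ∈ Proj.basicOpen (grading K n) (X j.succ) := h3
  rw [h2] at h4
  exact point_notMem_basicOpen_X_succ j h4

end Chart

/-! ### Vanishing of forms on a subscheme of the chart, and apolarity. -/

section Vanishing

variable {K : Type u} [Field K] {n : ℕ}

theorem awayToSection_comp_appLE {A : Type u} {σ : Type*} [CommRing A] [SetLike σ A]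
    [AddSubgroupClass σ A] (𝒜 : ℕ → σ) [GradedRing 𝒜] {f : A} {m : ℕ} (hf : f ∈ 𝒜 m) (hm : 0 < m)
    {B : CommRingCat.{u}} (φ : CommRingCat.of (HomogeneousLocalization.Away 𝒜 f) ⟶ B) (h) :
    Proj.awayToSection 𝒜 f ≫
        (Spec.map φ ≫ Proj.awayι 𝒜 f hf hm).appLE (Proj.basicOpen 𝒜 f) ⊤ h =
      φ ≫ (Scheme.ΓSpecIso B).inv := by
  let j : Spec B ⟶ (Proj.basicOpen 𝒜 f).toScheme :=
    Spec.map φ ≫ (Proj.basicOpenIsoSpec 𝒜 f hf hm).inv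
  have hj : j ≫ Proj.basicOpenToSpec 𝒜 f = Spec.map φ := by
    rw [← Proj.basicOpenIsoSpec_hom 𝒜 f hf hm]
    simp [j]
  have h1 := congr(Scheme.Hom.appTop $hj)
  rw [Scheme.Hom.comp_appTop, Scheme.Hom.appTop, Proj.basicOpenToSpec_app_top] at h1
  have h2 : (Spec.map φ ≫ Proj.awayι 𝒜 f hf hm).appLE (Proj.basicOpen 𝒜 f) ⊤ h =
      (Proj.basicOpen 𝒜 f).topIso.inv ≫ j.appTop := by
    have : Spec.map φ ≫ Proj.awayι 𝒜 f hf hm = j ≫ (Proj.basicOpen 𝒜 f).ι := by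
      simp [j, Proj.awayι]
    simp only [this]
    rw [← Scheme.Hom.appLE_comp_appLE j _ _ ⊤ ⊤
      (Scheme.Opens.ι_preimage_self _).ge le_rfl]
    congr 1
  rw [h2]
  rw [← cancel_epi (Scheme.ΓSpecIso _).hom]
  simp only [Category.assoc] at h1 ⊢
  rw [h1]
  rw [← Category.assoc, Iso.eq_comp_inv]
  exact Scheme.ΓSpecIso_naturality φ

theorem app_eq_zero_iff_appLE_eq_zero {Y Z : Scheme.{u}} (f : Y ⟶ Z) {U : Z.Opens} {V : Y.Opens}
    (h : f ⁻¹ᵁ U = V) (s : Γ(Z, U)) : f.app U s = 0 ↔ f.appLE U V h.ge s = 0 := by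
  subst h
  rw [Scheme.Hom.appLE_eq_app]

theorem app_formQuotient_zero_iff (I : Ideal (MvPolynomial (Fin n) K)) {k : ℕ}
    {Ψ : MvPolynomial (Fin (n + 1)) K} (hΨ : Ψ ∈ grading K n k) :
    (chartSubscheme I).app (Proj.basicOpen (grading K n) (X 0)) (formQuotient 0 k Ψ hΨ) = 0 ↔
      dehomogenize K n Ψ ∈ I := by
  have hc : chartSubscheme I = Spec.map (CommRingCat.ofHom (chartRingHom K n) ≫
      CommRingCat.ofHom (Ideal.Quotient.mk I)) ≫
      Proj.awayι (grading K n) (X 0) (X_mem_grading K n 0) one_pos := by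
    rw [Spec.map_comp, Category.assoc]
    rfl
  have ht : chartSubscheme I ⁻¹ᵁ Proj.basicOpen (grading K n) (X 0) = ⊤ := by
    rw [← opensRange_chart, chartSubscheme, Scheme.Hom.comp_preimage]
    simp
  have h1 := awayToSection_comp_appLE (grading K n) (X_mem_grading K n 0) one_pos
    (CommRingCat.ofHom (chartRingHom K n) ≫ CommRingCat.ofHom (Ideal.Quotient.mk I))
    (hc ▸ ht.ge)
  simp only [← hc] at h1
  have h2 : (chartSubscheme I).appLE (Proj.basicOpen (grading K n) (X 0)) ⊤ ht.ge
      (formQuotient 0 k Ψ hΨ) = (Scheme.ΓSpecIso _).inv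
        (Ideal.Quotient.mk I (dehomogenize K n Ψ)) := by
    rw [← chartRingHom_mk k Ψ (by simpa using hΨ)]
    exact congr($h1 _)
  rw [app_eq_zero_iff_appLE_eq_zero _ ht, h2, ← Ideal.Quotient.eq_zero_iff_mem]
  exact map_eq_zero_iff _ (Scheme.ΓSpecIso _).symm.commRingCatIsoToRingEquiv.injective

/-- The preimage of `y_j ≠ 0` is empty for `j ≥ 1`, so its ring of sections is zero and only the
chart `y_0 ≠ 0` tests vanishing. -/
theorem app_formQuotient_succ_eq_zero {Γ : Scheme.{u}} {i : Γ ⟶ projSpace K n}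
    (hloc : IsLocalAtPoint i) (j : Fin n) {k : ℕ} {Ψ : MvPolynomial (Fin (n + 1)) K}
    (hΨ : Ψ ∈ grading K n k) :
    i.app (Proj.basicOpen (grading K n) (X j.succ)) (formQuotient j.succ k Ψ hΨ) = 0 := by
  have h : i ⁻¹ᵁ Proj.basicOpen (grading K n) (X j.succ) = ⊥ := by
    rw [eq_bot_iff]
    intro x hx
    have h1 : i x = point K n := by
      have : i x ∈ Set.range i := ⟨x, rfl⟩
      rwa [hloc] at this
    have h2 : i x ∈ Proj.basicOpen (grading K n) (X j.succ) := hx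
    rw [h1] at h2
    exact (point_notMem_basicOpen_X_succ j h2).elim
  have : Subsingleton Γ(Γ, i ⁻¹ᵁ Proj.basicOpen (grading K n) (X j.succ)) := by
    rw [h]
    infer_instance
  exact Subsingleton.elim _ _

theorem mem_idealOf_chartSubscheme {I : Ideal (MvPolynomial (Fin n) K)}
    {Γ : Scheme.{u}} {e : Γ ⟶ Spec (CommRingCat.of (MvPolynomial (Fin n) K ⧸ I))}
    (hloc : IsLocalAtPoint (e ≫ chartSubscheme I)) {k : ℕ} {Ψ : MvPolynomial (Fin (n + 1)) K}
    (hΨ : Ψ.IsHomogeneous k) (h : dehomogenize K n Ψ ∈ I) :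
    Ψ ∈ idealOf (e ≫ chartSubscheme I) := by
  refine Ideal.subset_span ⟨k, hΨ, fun j => ?_⟩
  induction j using Fin.cases with
  | zero =>
    refine (congr($(Scheme.Hom.comp_app e (chartSubscheme I) _) _)).trans ?_
    exact (congrArg (e.app _).hom ((app_formQuotient_zero_iff I hΨ).mpr h)).trans (map_zero _)
  | succ j => exact app_formQuotient_succ_eq_zero hloc j hΨ

theorem isApolar_chartSubscheme_annihilator {d : ℕ} {F : MvPolynomial (Fin (n + 1)) K}
    (hF : F.IsHomogeneous d) {g : MvPolynomial (Fin n) K}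
    (hg : tail d g = dehomogenize K n F) : IsApolar (chartSubscheme (annihilator g)) F := by
  refine Ideal.span_le.mpr ?_
  rintro Ψ ⟨k, hΨ, h⟩
  exact mem_annihilator_of_dehomogenize_mem hF hΨ hg ((app_formQuotient_zero_iff _ hΨ).mp (h 0))

end Vanishing

/-! ### Length as the dimension of the coordinate ring. -/

section Length

variable {K : Type u} [Field K] {n : ℕ}

theorem scalars_comp {Γ Γ' : Scheme.{u}} (h : Γ' ⟶ Γ) (i : Γ ⟶ projSpace K n) (a : K) :
    scalars (h ≫ i) a = h.appTop (scalars i a) := by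
  simp only [scalars, Category.assoc, Scheme.Hom.comp_appTop]
  rfl

theorem length_iso_comp {Γ Γ' : Scheme.{u}} (e : Γ' ≅ Γ) (i : Γ ⟶ projSpace K n) :
    length (e.hom ≫ i) = length i := by
  let : Module K Γ(Γ, ⊤) := Module.compHom _ (scalars i)
  let : Module K Γ(Γ', ⊤) := Module.compHom _ (scalars (e.hom ≫ i))
  have : IsIso e.hom.appTop := inferInstanceAs (IsIso (e.hom.app ⊤))
  let E : Γ(Γ, ⊤) ≃+* Γ(Γ', ⊤) := (asIso e.hom.appTop).commRingCatIsoToRingEquiv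
  let E' : Γ(Γ, ⊤) ≃ₗ[K] Γ(Γ', ⊤) :=
    { E with
      map_smul' := fun a x => by
        change e.hom.appTop (scalars i a * x) = scalars (e.hom ≫ i) a * e.hom.appTop x
        rw [map_mul, scalars_comp] }
  exact E'.length_eq.symm

theorem chart_toSpecField : chart K n ≫ toSpecField K n =
    Spec.map (CommRingCat.ofHom (algebraMap K (MvPolynomial (Fin n) K))) := by
  rw [chart, toSpecField, Category.assoc, Proj.awayι_toSpecZero_assoc, ← Spec.map_comp,
    ← Spec.map_comp]
  congr 1
  refine CommRingCat.hom_ext (RingHom.ext fun a => ?_)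
  have h : HomogeneousLocalization.fromZeroRingHom (grading K n) (Submonoid.powers (X 0))
      (algebraMap K (grading K n 0) a) = HomogeneousLocalization.Away.mk (grading K n)
        (X_mem_grading K n 0) 0 (C a) (by simp) := by
    refine HomogeneousLocalization.val_injective _ ?_
    rw [HomogeneousLocalization.Away.val_mk]
    simp only [pow_zero]
    rfl
  refine (congrArg (chartRingHom K n) h).trans ((chartRingHom_mk _ _ _).trans ?_)
  simp

theorem scalars_chartSubscheme (I : Ideal (MvPolynomial (Fin n) K)) (a : K) :
    scalars (chartSubscheme I) a =
      (Scheme.ΓSpecIso (CommRingCat.of (MvPolynomial (Fin n) K ⧸ I))).inv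
        (algebraMap K (MvPolynomial (Fin n) K ⧸ I) a) := by
  have h : chartSubscheme I ≫ toSpecField K n =
      Spec.map (CommRingCat.ofHom (algebraMap K (MvPolynomial (Fin n) K ⧸ I))) := by
    rw [chartSubscheme, Category.assoc, chart_toSpecField, ← Spec.map_comp]
    rfl
  rw [scalars, h, RingHom.comp_apply]
  have h2 := Scheme.ΓSpecIso_inv_naturality
    (CommRingCat.ofHom (algebraMap K (MvPolynomial (Fin n) K ⧸ I)))
  exact congr($h2 a).symm

theorem length_chartSubscheme (I : Ideal (MvPolynomial (Fin n) K)) :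
    length (chartSubscheme I) = Module.length K (MvPolynomial (Fin n) K ⧸ I) := by
  let A := CommRingCat.of (MvPolynomial (Fin n) K ⧸ I)
  let : Module K Γ(Spec A, ⊤) := Module.compHom _ (scalars (chartSubscheme I))
  let E : A ≃+* Γ(Spec A, ⊤) := (Scheme.ΓSpecIso A).symm.commRingCatIsoToRingEquiv
  let E' : (MvPolynomial (Fin n) K ⧸ I) ≃ₗ[K] Γ(Spec A, ⊤) :=
    { E with
      map_smul' := fun a x => by
        change (Scheme.ΓSpecIso A).inv (a • x) =
          scalars (chartSubscheme I) a * (Scheme.ΓSpecIso A).inv x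
        rw [scalars_chartSubscheme]
        exact (congrArg _ (Algebra.smul_def a x)).trans (map_mul _ _ _) }
  exact E'.length_eq.symm

theorem eq_of_le_of_length_le {R : Type*} [CommRing R] [Algebra K R] {I J : Ideal R}
    [Module.Finite K (R ⧸ I)] (h : I ≤ J)
    (hlen : Module.length K (R ⧸ I) ≤ Module.length K (R ⧸ J)) : I = J := by
  let q : (R ⧸ I) →ₗ[K] (R ⧸ J) := (Ideal.Quotient.factorₐ K h).toLinearMap
  have hq : Function.Surjective q := Ideal.Quotient.factor_surjective h
  have : Module.Finite K (R ⧸ J) := .of_surjective q hq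
  rw [Module.length_eq_finrank, Module.length_eq_finrank, Nat.cast_le] at hlen
  have hfr := le_antisymm hlen (LinearMap.finrank_le_finrank_of_surjective hq)
  have hinj : Function.Injective q :=
    (LinearMap.injective_iff_surjective_of_finrank_eq_finrank hfr).mpr hq
  refine le_antisymm h fun x hx => ?_
  rw [← Ideal.Quotient.eq_zero_iff_mem] at hx ⊢
  exact hinj (by simpa [q] using hx)

end Length

end LocalApolar

/-! ### Comparison of `Γ` with `Z_g` by minimality. -/

theorem mainTheorem2 {K : Type u} [Field K] {n d : ℕ}
    (F : MvPolynomial (Fin (n + 1)) K) (hF : F.IsHomogeneous d) (hF0 : F ≠ 0)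
    {Γ : Scheme.{u}} (i : Γ ⟶ LocalApolar.projSpace K n) (hi : IsClosedImmersion i)
    (hloc : LocalApolar.IsLocalAtPoint i) (hapolar : LocalApolar.IsApolar i F)
    (hmin : ∀ (Γ' : Scheme.{u}) (i' : Γ' ⟶ LocalApolar.projSpace K n), IsClosedImmersion i' →
      LocalApolar.IsLocalAtPoint i' → LocalApolar.IsApolar i' F →
      LocalApolar.length i ≤ LocalApolar.length i') :
    ∃ g : MvPolynomial (Fin n) K,
      LocalApolar.tail d g = LocalApolar.dehomogenize K n F ∧
      ∃ e : Γ ≅ LocalApolar.affineApolarScheme g,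
        e.hom ≫ LocalApolar.affineApolarSchemeι g = i := by
  open LocalApolar in
  obtain ⟨I, e, rfl⟩ := exists_iso_chartSubscheme i hloc
  have hrange : Set.range (e.hom ≫ chartSubscheme I) = Set.range (chartSubscheme I) := by
    rw [Scheme.Hom.comp_base, TopCat.coe_comp]
    exact (Scheme.homeoOfIso e).surjective.range_comp _
  have hlocI : IsLocalAtPoint (chartSubscheme I) := hrange.symm.trans hloc
  have hrad := X_mem_radical_of_isLocalAtPoint hlocI
  have hpair : ∀ ψ ∈ I, ψ.totalDegree ≤ d →
      coeff 0 (contraction ψ (dehomogenize K n F)) = 0 := fun ψ hψ hd => by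
    refine coeff_zero_contraction_eq_zero_of_mem hF (fun Ψ hΨ hmem => hapolar ?_) hψ hd
    exact mem_idealOf_chartSubscheme hloc hΨ hmem
  obtain ⟨g, hg, hIg⟩ := exists_tail_eq_of_le (finite_monomial_notMem hrad)
    (totalDegree_dehomogenize_le hF) hpair
  have hg0 : g ≠ 0 := by
    rintro rfl
    refine hF0 (dehomogenize_eq_zero hF ?_)
    rw [← hg]
    simp [tail]
  have hlocg : IsLocalAtPoint (chartSubscheme (annihilator g)) := by
    have : Nontrivial (MvPolynomial (Fin n) K ⧸ annihilator g) :=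
      Ideal.Quotient.nontrivial_iff.mpr (annihilator_ne_top hg0)
    have : Nonempty (Spec (CommRingCat.of (MvPolynomial (Fin n) K ⧸ annihilator g))) :=
      inferInstanceAs (Nonempty (PrimeSpectrum _))
    -- `I ≤ annihilator g` puts the support inside the single point supporting `V(I)`.
    refine (Set.range_nonempty _).subset_singleton_iff.mp ?_
    rw [← hlocI, ← chartSubscheme_comp hIg, Scheme.Hom.comp_base, TopCat.coe_comp]
    exact Set.range_comp_subset_range _ _
  -- The range is the same point as that of `Γ`, which is closed because `Γ` is a closed subscheme.
  have hclosed : IsClosedImmersion (chartSubscheme (annihilator g)) :=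
    .of_isPreimmersion _ <| by
      rw [hlocg, ← hloc]
      exact (e.hom ≫ chartSubscheme I).isClosedEmbedding.isClosed_range
  have hle := hmin _ _ hclosed hlocg (isApolar_chartSubscheme_annihilator hF hg)
  rw [length_iso_comp, length_chartSubscheme, length_chartSubscheme] at hle
  have := finite_quotient_of_X_mem_radical hrad
  obtain rfl := eq_of_le_of_length_le hIg hle
  exact ⟨g, hg, e, rfl⟩
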